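/- A $*$-category is a category with an involution $f \mapsto f^*$ on morphisms ($f^*\colon Y \to X$ for $f\colon X\to Y$) such that $1^*=1$, $(gf)^*=f^*g^*$ and $f^{**}=f$. A morphism $f$ is isometric if $f^*f=1$ and coisometric if $ff^*=1$. A finite product $(p_j\colon \bigoplus_j X_j \to X_j)_j$ in a $*$-category with a zero object is orthonormal if each $p_j$ is coisometric and $p_jp_k^*=0$ for $j\neq k$. A pre-Hilbert $*$-category is a $*$-category with a zero object, binary orthonormal products and isometric kernels, in which every diagonal $\langle 1,1\rangle\colon X\to X\oplus X$ is a kernel. Its parallel morphisms are added by means of the (bi)products, and endomorphisms are ordered by: $f\le g$ if and only if $g-f=h^*h$ for some morphism $h$; $f$ is a contraction if $f^*f\le 1$. Let $(f_{i\le k}\colon X_k\to X_i)_{i,k\in I}$ be a codirected diagram of contractions in a pre-Hilbert $*$-category, indexed by a (small) directed set $I$. An $\ell^2$-cone on it is a cone $(g_i\colon Y\to X_i)_{i\in I}$ such that the net $(g_i^*g_i)_{i\in I}$ is bounded above. An $\ell^2$-limit is an $\ell^2$-cone $(f_i\colon X\to X_i)_{i\in I}$ such that for each $\ell^2$-cone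 $(g_i\colon Y\to X_i)_{i\in I}$ there is a unique $g\colon Y\to X$ with $f_ig=g_i$ for all $i$, and this $g$ satisfies $g^*g=\sup_{i}g_i^*g_i$. A Hilbert $*$-category is a pre-Hilbert $*$-category that has $\ell^2$-limits of all such diagrams. Let $(X_j)_{j\in J}$ be a (small) family of objects of a pre-Hilbert $*$-category. An $\ell^2$-span on it is a span $(g_j\colon Y\to X_j)_{j\in J}$ such that the net $\bigl(\sum_{j\in F}g_j^*g_j\bigr)_F$, indexed by the finite subsets $F\subseteq J$, is bounded above. An $\ell^2$-product of it is an $\ell^2$-span $(r_j\colon X\to X_j)_{j\in J}$ such that for each $\ell^2$-span $(g_j\colon Y\to X_j)_{j\in J}$ there is a unique $g\colon Y\to X$ with $r_jg=g_j$ for all $j$, and this $g$ satisfies $g^*g=\sup_F\sum_{j\in F}g_j^*g_j$. **Theorem.** (1) Let $(X_j)_{j\in J}$ be a family of objects of a pre-Hilbert $*$-category. Each finite subfamily $(X_j)_{j\in F}$ has an orthonormal product. For every choice of orthonormal products $(p_j\colon\bigoplus_{j\in F}X_j\to X_j)_{j\in F}$, one for each finite $F\subseteq J$, the canonical morphisms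 $p_F\colon\bigoplus_{j\in G}X_j\to\bigoplus_{j\in F}X_j$ for $F\subseteq G$ form a codirected diagram of coisometries, which are also contractions. Sending a span $(g_j\colon Y\to X_j)_{j\in J}$ to the cone $(g_F)_F$, where $g_F\colon Y\to\bigoplus_{j\in F}X_j$ is the unique morphism with $p_jg_F=g_j$ for all $j\in F$, and each morphism of spans to itself, is an isomorphism from the category of spans on $(X_j)_{j\in J}$ to the category of cones on this diagram, whose inverse sends a cone $(g_F)_F$ to the span $(p_jg_{\{j\}})_{j\in J}$ and each morphism of cones to itself. A span is an $\ell^2$-span if and only if the corresponding cone is an $\ell^2$-cone, and it is an $\ell^2$-product if and only if the corresponding cone is an $\ell^2$-limit. (2) Every Hilbert $*$-category has all $\ell^2$-products: every family of objects has an $\ell^2$-product. -/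

import Mathlib

open CategoryTheory CategoryTheory.Limits

universe w v u

attribute [local instance 2000] CategoryStruct.toQuiver

/-- A `*`-category: a category with an involutive, identity-on-objects, contravariant choice
`dag f : Y ⟶ X` of a morphism for each `f : X ⟶ Y`. -/
class StarCategory (C : Type u) [Category.{v} C] where
  /-- The involution, written `f ↦ f^*` on paper. -/
  dag : ∀ {X Y : C}, (X ⟶ Y) → (Y ⟶ X)
  dag_id : ∀ X : C, dag (𝟙 X) = 𝟙 X
  dag_comp : ∀ {X Y Z : C} (f : X ⟶ Y) (g : Y ⟶ Z), dag (f ≫ g) = dag g ≫ dag f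
  dag_dag : ∀ {X Y : C} (f : X ⟶ Y), dag (dag f) = f

namespace StarCategory

section StarOnly

variable {C : Type u} [Category.{v} C] [StarCategory C]

/-- `f` is isometric if `f^* f = 1`. -/
def IsIsometric {X Y : C} (f : X ⟶ Y) : Prop :=
  f ≫ dag f = 𝟙 X

/-- `f` is coisometric if `f f^* = 1`. -/
def IsCoisometric {X Y : C} (f : X ⟶ Y) : Prop :=
  dag f ≫ f = 𝟙 Y

/-- A binary product `(r₁ : P ⟶ X, r₂ : P ⟶ Y)` is orthonormal if its two projections are
coisometries and `r₁ r₂^* = 0`. -/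
structure IsOrthonormalBinaryProduct [HasZeroMorphisms C] {P X Y : C} (r₁ : P ⟶ X) (r₂ : P ⟶ Y) :
    Prop where
  isProduct : Nonempty (IsLimit (BinaryFan.mk r₁ r₂))
  coisometric_fst : IsCoisometric r₁
  coisometric_snd : IsCoisometric r₂
  orthogonal : dag r₂ ≫ r₁ = 0

/-- An orthonormal product of a family of objects (used for finite families): a product cone
whose projections `p_j` are coisometries that satisfy `p_j p_k^* = 0` for `j ≠ k`. -/
structure OrthonormalProduct [HasZeroMorphisms C] {ι : Type w} (X : ι → C) where
  /-- The underlying span `(p_j : ⨁ X ⟶ X_j)_j`. -/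
  fan : Fan X
  /-- It is a product in the ordinary sense. -/
  isLimit : IsLimit fan
  coisometric : ∀ j, IsCoisometric (fan.proj j)
  orthogonal : ∀ j k, j ≠ k → dag (fan.proj k) ≫ fan.proj j = 0

/-- `k` is a kernel of `f`. -/
def IsKernelOf [HasZeroMorphisms C] {K X Y : C} (k : K ⟶ X) (f : X ⟶ Y) : Prop :=
  ∃ h : k ≫ f = 0, Nonempty (IsLimit (KernelFork.ofι k h))

end StarOnly

end StarCategory

open StarCategory

section PreHilbert

attribute [local instance] HasZeroObject.zeroMorphismsOfZeroObject

/-- A pre-Hilbert `*`-category: a `*`-category with a zero object, binary orthonormal products and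
isometric kernels, in which every diagonal `⟨1, 1⟩ : X ⟶ X ⊕ X` is a kernel. Zero morphisms are the
ones that factor through a zero object. -/
class PreHilbertStarCategory (C : Type u) [Category.{v} C] [StarCategory C] : Prop
    extends HasZeroObject C where
  exists_orthonormal_binary_product : ∀ X Y : C,
    ∃ (P : C) (r₁ : P ⟶ X) (r₂ : P ⟶ Y), IsOrthonormalBinaryProduct r₁ r₂
  exists_isometric_kernel : ∀ {X Y : C} (f : X ⟶ Y),
    ∃ (K : C) (k : K ⟶ X), IsIsometric k ∧ IsKernelOf k f
  diagonal_isKernel : ∀ {X P : C} (r₁ r₂ : P ⟶ X), IsOrthonormalBinaryProduct r₁ r₂ →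
    ∀ d : X ⟶ P, d ≫ r₁ = 𝟙 X → d ≫ r₂ = 𝟙 X → ∃ (Z : C) (m : P ⟶ Z), IsKernelOf d m

end PreHilbert

namespace PreHilbertStarCategory

variable {C : Type u} [Category.{v} C] [StarCategory C] [PreHilbertStarCategory C]

noncomputable instance hasZeroMorphisms : HasZeroMorphisms C :=
  HasZeroObject.zeroMorphismsOfZeroObject

theorem dag_zero (X Y : C) : dag (0 : X ⟶ Y) = 0 := by
  have h : (0 : X ⟶ Y) = (0 : X ⟶ X) ≫ (0 : X ⟶ Y) := by simp
  have h0 : (0 : X ⟶ Y) = (0 : X ⟶ (HasZeroObject.zero' C).zero) ≫ 0 := by simp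
  rw [h0, dag_comp]
  have : (dag (0 : (HasZeroObject.zero' C).zero ⟶ Y)) = 0 :=
    (isZero_zero C).eq_of_tgt _ _
  rw [this, zero_comp]

/-- Orthonormal binary products are biproducts. -/
instance hasBinaryBiproducts : HasBinaryBiproducts C where
  has_binary_biproduct X Y := by
    obtain ⟨P, r₁, r₂, hs⟩ := exists_orthonormal_binary_product X Y
    obtain ⟨hl⟩ := hs.isProduct
    have lift : ∀ {T : C} (f : T ⟶ X) (g : T ⟶ Y), ∃ l : T ⟶ P, l ≫ r₁ = f ∧ l ≫ r₂ = g :=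
      fun f g => ⟨(BinaryFan.IsLimit.lift' hl f g).1, (BinaryFan.IsLimit.lift' hl f g).2⟩
    have ext : ∀ {T : C} {a b : T ⟶ P}, a ≫ r₁ = b ≫ r₁ → a ≫ r₂ = b ≫ r₂ → a = b :=
      fun h1 h2 => BinaryFan.IsLimit.hom_ext hl h1 h2
    choose l hl1 hl2 using @lift
    have h10 : dag r₁ ≫ r₂ = 0 := by
      have h := congrArg dag hs.orthogonal
      rw [dag_comp, dag_dag] at h
      exact h.trans (dag_zero _ _)
    let b : BinaryBicone X Y :=
      { pt := P
        fst := r₁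
        snd := r₂
        inl := dag r₁
        inr := dag r₂
        inl_fst := hs.coisometric_fst
        inl_snd := h10
        inr_fst := hs.orthogonal
        inr_snd := hs.coisometric_snd }
    have d1 : ∀ {T : C} (f : X ⟶ T) (g : Y ⟶ T), dag r₁ ≫ dag (l (dag f) (dag g)) = f :=
      fun f g => by rw [← dag_comp, hl1, dag_dag]
    have d2 : ∀ {T : C} (f : X ⟶ T) (g : Y ⟶ T), dag r₂ ≫ dag (l (dag f) (dag g)) = g :=
      fun f g => by rw [← dag_comp, hl2, dag_dag]
    have d3 : ∀ {T : C} (f : X ⟶ T) (g : Y ⟶ T) (m : P ⟶ T), dag r₁ ≫ m = f → dag r₂ ≫ m = g →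
        m = dag (l (dag f) (dag g)) := fun f g m h1 h2 => by
      rw [← dag_dag m]
      refine congrArg dag (ext ?_ ?_)
      · rw [hl1, ← h1, dag_comp, dag_dag]
      · rw [hl2, ← h2, dag_comp, dag_dag]
    have hcolim : IsColimit b.toCocone :=
      BinaryCofan.IsColimit.mk _ (fun f g => dag (l (dag f) (dag g))) d1 d2 d3
    exact HasBinaryBiproduct.mk ⟨b, ⟨hl, hcolim⟩⟩

/-- The canonical addition of parallel morphisms, derived from binary biproducts. -/
noncomputable instance addCommMonoidHom (X Y : C) : AddCommMonoid (X ⟶ Y) :=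
  SemiadditiveOfBinaryBiproducts.addCommMonoidHomOfHasBinaryBiproducts X Y

/-- The canonical order on (Hermitian) endomorphisms: `f ≤ g` when `g - f = h^* h` for some
morphism `h : A ⟶ X`, with the equation written as `f + h^* h = g`. -/
def Le {A : C} (f g : A ⟶ A) : Prop :=
  ∃ (X : C) (h : A ⟶ X), f + h ≫ dag h = g

/-- `b` is an upper bound of the family `a` of endomorphisms. -/
def IsUpperBound {A : C} {I : Type w} (a : I → (A ⟶ A)) (b : A ⟶ A) : Prop :=
  ∀ i, Le (a i) b

/-- `b` is the supremum of the family `a` of endomorphisms. -/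
def IsSupremum {A : C} {I : Type w} (a : I → (A ⟶ A)) (b : A ⟶ A) : Prop :=
  IsUpperBound a b ∧ ∀ c : A ⟶ A, IsUpperBound a c → Le b c

/-- `f` is a contraction if `f^* f ≤ 1`. -/
def IsContraction {X Y : C} (f : X ⟶ Y) : Prop :=
  Le (f ≫ dag f) (𝟙 X)

section L2Limit

variable {I : Type w} [Preorder I] {D : Iᵒᵖ ⥤ C}

/-- A cone `(g_i : Y ⟶ X_i)_i` on a codirected diagram `D` (a functor `Iᵒᵖ ⥤ C`) is an `ℓ²`-cone
if the net `(g_i^* g_i)_i` of endomorphisms of `Y` is bounded above. -/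
def IsL2Cone (c : Cone D) : Prop :=
  ∃ b : c.pt ⟶ c.pt,
    IsUpperBound (fun i : I => c.π.app (Opposite.op i) ≫ dag (c.π.app (Opposite.op i))) b

/-- An `ℓ²`-cone `(f_i : X ⟶ X_i)_i` is an `ℓ²`-limit if for each `ℓ²`-cone `(g_i : Y ⟶ X_i)_i`
there is a unique `g : Y ⟶ X` with `f_i g = g_i` for all `i`, and `g^* g = sup_i g_i^* g_i`. -/
def IsL2Limit (c : Cone D) : Prop :=
  IsL2Cone c ∧ ∀ t : Cone D, IsL2Cone t →
    (∃! g : t.pt ⟶ c.pt, ∀ i : Iᵒᵖ, g ≫ c.π.app i = t.π.app i) ∧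
    ∀ g : t.pt ⟶ c.pt, (∀ i : Iᵒᵖ, g ≫ c.π.app i = t.π.app i) →
      IsSupremum (fun i : I => t.π.app (Opposite.op i) ≫ dag (t.π.app (Opposite.op i)))
        (g ≫ dag g)

end L2Limit

section L2Product

variable {J : Type w} {X : J → C}

/-- A span `(g_j : Y ⟶ X_j)_j` is an `ℓ²`-span if the net `(∑_{j ∈ F} g_j^* g_j)_F`, indexed by the
finite subsets `F` of `J`, is bounded above. -/
def IsL2Span (s : Fan X) : Prop :=
  ∃ b : s.pt ⟶ s.pt,
    IsUpperBound (fun F : Finset J => ∑ j ∈ F, s.proj j ≫ dag (s.proj j)) b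

/-- An `ℓ²`-span `(r_j : X ⟶ X_j)_j` is an `ℓ²`-product if for each `ℓ²`-span `(g_j : Y ⟶ X_j)_j`
there is a unique `g : Y ⟶ X` with `r_j g = g_j` for all `j`, and
`g^* g = sup_F ∑_{j ∈ F} g_j^* g_j`. -/
def IsL2Product (s : Fan X) : Prop :=
  IsL2Span s ∧ ∀ t : Fan X, IsL2Span t →
    (∃! g : t.pt ⟶ s.pt, ∀ j, g ≫ s.proj j = t.proj j) ∧
    ∀ g : t.pt ⟶ s.pt, (∀ j, g ≫ s.proj j = t.proj j) →
      IsSupremum (fun F : Finset J => ∑ j ∈ F, t.proj j ≫ dag (t.proj j)) (g ≫ dag g)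

end L2Product

section FiniteProducts

variable {J : Type w} {X : J → C}

/-- The codirected diagram `(p_F : ⨁_{j ∈ G} X_j ⟶ ⨁_{j ∈ F} X_j)_{F ⊆ G}` of chosen finite
orthonormal products, indexed by the finite subsets of `J`. -/
def finiteProductDiagram (P : ∀ F : Finset J, OrthonormalProduct (fun j : F => X j)) :
    (Finset J)ᵒᵖ ⥤ C where
  obj F := (P F.unop).fan.pt
  map {G F} f := Fan.IsLimit.lift (P F.unop).isLimit
    (fun j => (P G.unop).fan.proj ⟨j.1, leOfHom f.unop j.2⟩)
  map_id G := Fan.IsLimit.hom_ext (P G.unop).isLimit _ _ (fun j => by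
    rw [Fan.IsLimit.fac, Category.id_comp])
  map_comp {G F E} f g := Fan.IsLimit.hom_ext (P E.unop).isLimit _ _ (fun j => by
    rw [Fan.IsLimit.fac, Category.assoc, Fan.IsLimit.fac, Fan.IsLimit.fac])

/-- The projection `p_j : ⨁_{j ∈ F} X_j ⟶ X_j`, as a morphism out of an object of the diagram. -/
def diagramProj (P : ∀ F : Finset J, OrthonormalProduct (fun j : F => X j)) (F : (Finset J)ᵒᵖ)
    (j : F.unop) : (finiteProductDiagram P).obj F ⟶ X j :=
  (P F.unop).fan.proj j

/-- The unique morphism `Y ⟶ ⨁_{j ∈ F} X_j` with given components. -/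
def diagramLift (P : ∀ F : Finset J, OrthonormalProduct (fun j : F => X j)) (F : (Finset J)ᵒᵖ)
    {Y : C} (g : ∀ j : F.unop, Y ⟶ X j) : Y ⟶ (finiteProductDiagram P).obj F :=
  Fan.IsLimit.lift (P F.unop).isLimit g

variable (P : ∀ F : Finset J, OrthonormalProduct (fun j : F => X j))

theorem diagramLift_proj (F : (Finset J)ᵒᵖ) {Y : C} (g : ∀ j : F.unop, Y ⟶ X j) (j : F.unop) :
    diagramLift P F g ≫ diagramProj P F j = g j :=
  Fan.IsLimit.fac (P F.unop).isLimit g j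

theorem diagramMap_proj {G F : (Finset J)ᵒᵖ} (f : G ⟶ F) (j : F.unop) :
    (finiteProductDiagram P).map f ≫ diagramProj P F j =
      diagramProj P G ⟨j.1, leOfHom f.unop j.2⟩ :=
  Fan.IsLimit.fac (P F.unop).isLimit _ j

theorem diagram_hom_ext {F : (Finset J)ᵒᵖ} {Y : C} {a b : Y ⟶ (finiteProductDiagram P).obj F}
    (h : ∀ j, a ≫ diagramProj P F j = b ≫ diagramProj P F j) : a = b :=
  Fan.IsLimit.hom_ext (P F.unop).isLimit a b h

/-- The canonical functor from spans to cones: `(g_j)_j` is sent to `(g_F)_F` where `g_F` is the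
unique morphism with `p_j g_F = g_j` for all `j ∈ F`; morphisms are sent to themselves. -/
def spanToCone : Fan X ⥤ Cone (finiteProductDiagram P) where
  obj s :=
    { pt := s.pt
      π :=
        { app := fun F => diagramLift P F (fun j => s.proj j.1)
          naturality := fun G F f => diagram_hom_ext P (fun j => by
            rw [Category.assoc, Category.assoc, diagramMap_proj, diagramLift_proj,
              diagramLift_proj]
            exact Category.id_comp _) } }
  map {s t} f :=
    { hom := f.hom
      w := fun F => diagram_hom_ext P (fun j => by
        rw [Category.assoc, diagramLift_proj, diagramLift_proj]
        exact f.w ⟨j.1⟩) }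
  map_id s := rfl
  map_comp f g := rfl

/-- The canonical functor from cones to spans: `(g_F)_F` is sent to `(p_j g_{{j}})_j`, which is
`(g_{{j}})_j` when the product of the one-object family `X_j` is chosen to be `X_j`; morphisms are
sent to themselves. -/
def coneToSpan : Cone (finiteProductDiagram P) ⥤ Fan X where
  obj c := Fan.mk c.pt (fun j => c.π.app (Opposite.op {j}) ≫
    diagramProj P (Opposite.op {j}) ⟨j, Finset.mem_singleton_self j⟩)
  map {c d} f :=
    { hom := f.hom
      w := fun ⟨j⟩ => by
        have h := congrArg
          (fun g => g ≫ diagramProj P (Opposite.op {j}) ⟨j, Finset.mem_singleton_self j⟩)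
          (f.w (Opposite.op {j}))
        exact (Category.assoc _ _ _).symm.trans h }
  map_id c := rfl
  map_comp f g := rfl

end FiniteProducts

end PreHilbertStarCategory

open PreHilbertStarCategory

/-- A Hilbert `*`-category: a pre-Hilbert `*`-category with `ℓ²`-limits of all codirected diagrams
of contractions, indexed by directed sets in the universe `w`. -/
class HilbertStarCategory (C : Type u) [Category.{v} C] [StarCategory C] : Prop
    extends PreHilbertStarCategory C where
  exists_l2Limit : ∀ (I : Type w) [Preorder I] [IsDirectedOrder I] [Nonempty I] (D : Iᵒᵖ ⥤ C),
    (∀ {i j : Iᵒᵖ} (f : i ⟶ j), IsContraction (D.map f)) → ∃ c : Cone D, IsL2Limit c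

/-! Everything rests on one identity: the projections of a finite orthonormal product satisfy `∑
p_j^* p_j = 1` (`sum_proj_dag_proj`), so `g^* g = ∑ (p_j g)^* (p_j g)` for every `g` into it
(`comp_dag_eq_sum`). Hence `g_F^* g_F = ∑_{j ∈ F} g_j^* g_j` when `(g_F)` is the cone of a span
`(g_j)`: the two nets are equal, and so are their upper bounds and suprema. The same morphisms
factor a span and its cone, so the `ℓ²` notions agree.

The same identity, split over `F` and `G \ F`, shows that the diagram consists of contractions. So a
Hilbert `*`-category has an `ℓ²`-limit of it, and the corresponding span is an `ℓ²`-product. Finite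
orthonormal products are built by adjoining one object at a time. -/

/-! ### Strict equality of cones and of functors between cone categories. -/

/-- An endofunctor of a category of cones that fixes every cone and every underlying morphism is
the identity. -/
theorem endofunctor_cone_eq_id {C : Type u} [Category.{v} C] {K : Type*} [Category K]
    {D : K ⥤ C} (T : Cone D ⥤ Cone D)
    (hobj : ∀ c, T.obj c = c) (hmap : ∀ {c d : Cone D} (f : c ⟶ d), (T.map f).hom ≍ f.hom) :
    T = 𝟭 (Cone D) := by
  refine CategoryTheory.Functor.hext hobj fun c d f => ?_
  -- With four independent cones, the equalities of objects can be eliminated by substitution, which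
  -- leaves an honest equality of morphisms.
  have key : ∀ {a b c d : Cone D} (g : a ⟶ b) (f : c ⟶ d), a = c → b = d → g.hom ≍ f.hom →
      g ≍ f := by
    rintro a b _ _ g f rfl rfl h
    exact heq_of_eq (ConeMorphism.ext _ _ (eq_of_heq h))
  exact key _ _ (hobj c) (hobj d) (hmap f)

/-- Reduces a strict equality of cones to one leg at a time when the apex is already the same. It
serves spans too, as a `Fan` is a cone on a discrete diagram. -/
theorem cone_mk_ext {C : Type u} [Category.{v} C] {K : Type*} [Category K] {D : K ⥤ C} {c : Cone D}
    {π : (CategoryTheory.Functor.const K).obj c.pt ⟶ D} (h : ∀ k, π.app k = c.π.app k) :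
    Cone.mk c.pt π = c := by
  obtain ⟨pt, π'⟩ := c
  congr 1
  exact NatTrans.ext (funext h)

/-! ### Existence of finite orthonormal products. -/

namespace StarCategory

variable {C : Type u} [Category.{v} C] [StarCategory C]

/-- Transport of an orthonormal product along a bijection of the index types. -/
theorem OrthonormalProduct.nonempty_of_equiv [HasZeroMorphisms C] {ι κ : Type w} (e : ι ≃ κ)
    {X : κ → C} (P : OrthonormalProduct (fun i => X (e i))) :
    Nonempty (OrthonormalProduct X) := by
  -- `Equiv.piCongrLeft` absorbs the casts between `X (e (e.symm k))` and `X k`; afterwards only the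
  -- values at `e i` are used.
  let p : ∀ k, P.fan.pt ⟶ X k := e.piCongrLeft (fun k => P.fan.pt ⟶ X k) P.fan.proj
  have hp : ∀ i, p (e i) = P.fan.proj i := fun i =>
    e.piCongrLeft_apply_apply (fun k => P.fan.pt ⟶ X k) P.fan.proj i
  refine ⟨⟨Fan.mk P.fan.pt p,
    Fan.IsLimit.mk _ (fun s => Fan.IsLimit.lift P.isLimit fun i => s.proj (e i)) ?_ ?_, ?_, ?_⟩⟩
  · intro s k
    obtain ⟨i, rfl⟩ := e.surjective k
    rw [fan_mk_proj, hp]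
    exact Fan.IsLimit.fac _ _ _
  · intro s m hm
    refine Fan.IsLimit.hom_ext P.isLimit _ _ fun i => ?_
    have h := hm (e i)
    rw [fan_mk_proj, hp] at h
    exact h.trans (Fan.IsLimit.fac P.isLimit (fun i => s.proj (e i)) i).symm
  · intro k
    obtain ⟨i, rfl⟩ := e.surjective k
    rw [fan_mk_proj, hp]
    exact P.coisometric i
  · intro k l hkl
    obtain ⟨i, rfl⟩ := e.surjective k
    obtain ⟨j, rfl⟩ := e.surjective l
    rw [fan_mk_proj, hp, hp]
    exact P.orthogonal i j fun h => hkl (congrArg e h)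

end StarCategory

namespace PreHilbertStarCategory

variable {C : Type u} [Category.{v} C] [StarCategory C] [PreHilbertStarCategory C]

/-- The zero object is an orthonormal product of the empty family. -/
theorem nonempty_orthonormalProduct_of_isEmpty {ι : Type w} [IsEmpty ι] (X : ι → C) :
    Nonempty (OrthonormalProduct X) := by
  obtain ⟨Z, hZ⟩ := HasZeroObject.zero (C := C)
  exact ⟨⟨Fan.mk Z isEmptyElim, Fan.IsLimit.mk _ (fun _ => 0) (fun _ j => isEmptyElim j)
    (fun _ _ _ => hZ.eq_of_tgt _ _), fun j => isEmptyElim j, fun j => isEmptyElim j⟩⟩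

/-- An orthonormal product of `X none` with an orthonormal product of the other objects. -/
theorem nonempty_orthonormalProduct_option {ι : Type w} (X : Option ι → C)
    (P : OrthonormalProduct (fun i => X (some i))) : Nonempty (OrthonormalProduct X) := by
  obtain ⟨Q, r₁, r₂, hr⟩ := exists_orthonormal_binary_product (X none) P.fan.pt
  obtain ⟨hl⟩ := hr.isProduct
  have h10 : dag r₁ ≫ r₂ = 0 := by
    have h := congrArg dag hr.orthogonal
    rw [dag_comp, dag_dag] at h
    exact h.trans (dag_zero _ _)
  have hc₂ : dag r₂ ≫ r₂ = 𝟙 P.fan.pt := hr.coisometric_snd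
  let p : ∀ k, Q ⟶ X k := fun k =>
    match k with
    | none => r₁
    | some i => r₂ ≫ P.fan.proj i
  have hp₀ : p none = r₁ := rfl
  have hp : ∀ i, p (some i) = r₂ ≫ P.fan.proj i := fun _ => rfl
  have hdag : ∀ i {Z : C} (f : Q ⟶ Z), dag (p (some i)) ≫ f = dag (P.fan.proj i) ≫ dag r₂ ≫ f :=
    fun i Z f => by rw [hp, dag_comp, Category.assoc]
  refine ⟨⟨Fan.mk Q p, Fan.IsLimit.mk _ (fun s => (BinaryFan.IsLimit.lift' hl (s.proj none)
    (Fan.IsLimit.lift P.isLimit fun i => s.proj (some i))).1) ?_ ?_, ?_, ?_⟩⟩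
  · intro s k
    have h := (BinaryFan.IsLimit.lift' hl (s.proj none)
      (Fan.IsLimit.lift P.isLimit fun i => s.proj (some i))).2
    cases k with
    | none => exact h.1
    | some i =>
      rw [fan_mk_proj, hp, ← Category.assoc]
      exact (congrArg (· ≫ P.fan.proj i) h.2).trans (Fan.IsLimit.fac _ _ _)
  · intro s m hm
    have h := (BinaryFan.IsLimit.lift' hl (s.proj none)
      (Fan.IsLimit.lift P.isLimit fun i => s.proj (some i))).2
    refine BinaryFan.IsLimit.hom_ext hl ((hm none).trans h.1.symm) (Eq.trans ?_ h.2.symm)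
    refine Fan.IsLimit.hom_ext P.isLimit _ _ fun i => ?_
    rw [Fan.IsLimit.fac, ← hm (some i), fan_mk_proj, hp]
    exact Category.assoc _ _ _
  · intro k
    rw [fan_mk_proj]
    cases k with
    | none => exact hr.coisometric_fst
    | some i =>
      change dag (p (some i)) ≫ p (some i) = _
      rw [hdag, hp, ← Category.assoc (dag r₂), hc₂, Category.id_comp]
      exact P.coisometric i
  · intro k l hkl
    rw [fan_mk_proj]
    cases k with
    | none =>
      cases l with
      | none => exact absurd rfl hkl
      | some j => rw [hdag, hp₀, hr.orthogonal, comp_zero]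
    | some i =>
      cases l with
      | none => rw [hp, hp₀, ← Category.assoc, h10, zero_comp]
      | some j =>
        rw [hdag, hp, ← Category.assoc (dag r₂), hc₂, Category.id_comp]
        exact P.orthogonal i j fun h => hkl (congrArg some h)

/-- Finite families have orthonormal products. -/
theorem nonempty_orthonormalProduct {ι : Type w} [Finite ι] :
    ∀ X : ι → C, Nonempty (OrthonormalProduct X) :=
  -- The motive ranges over all families, since both reindexing and adjoining a point change the
  -- family.
  Finite.induction_empty_option
    (P := fun ι : Type w => ∀ X : ι → C, Nonempty (OrthonormalProduct X))
    (fun e h X => (h fun i => X (e i)).elim fun P => OrthonormalProduct.nonempty_of_equiv e P)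
    nonempty_orthonormalProduct_of_isEmpty
    (fun h X => (h fun i => X (some i)).elim (nonempty_orthonormalProduct_option X)) ι

/-! ### Bilinearity of composition and the resolution of the identity. -/

theorem add_comp {X Y Z : C} (f g : X ⟶ Y) (h : Y ⟶ Z) : (f + g) ≫ h = f ≫ h + g ≫ h :=
  SemiadditiveOfBinaryBiproducts.add_comp f g h

theorem comp_add {X Y Z : C} (f : X ⟶ Y) (g h : Y ⟶ Z) : f ≫ (g + h) = f ≫ g + f ≫ h :=
  SemiadditiveOfBinaryBiproducts.comp_add f g h

theorem sum_comp {X Y Z : C} {ι : Type w} (s : Finset ι) (f : ι → (X ⟶ Y)) (h : Y ⟶ Z) :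
    (∑ i ∈ s, f i) ≫ h = ∑ i ∈ s, f i ≫ h :=
  map_sum (⟨⟨fun f => f ≫ h, zero_comp⟩, fun f g => add_comp f g h⟩ : (X ⟶ Y) →+ (X ⟶ Z)) f s

theorem comp_sum {X Y Z : C} {ι : Type w} (s : Finset ι) (f : X ⟶ Y) (g : ι → (Y ⟶ Z)) :
    f ≫ (∑ i ∈ s, g i) = ∑ i ∈ s, f ≫ g i :=
  map_sum (⟨⟨fun g => f ≫ g, comp_zero⟩, fun g h => comp_add f g h⟩ : (Y ⟶ Z) →+ (X ⟶ Z)) g s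

/-- The projections of a finite orthonormal product resolve the identity. -/
theorem sum_proj_dag_proj {ι : Type w} [Fintype ι] {X : ι → C} (P : OrthonormalProduct X) :
    ∑ i, P.fan.proj i ≫ dag (P.fan.proj i) = 𝟙 P.fan.pt := by
  refine Fan.IsLimit.hom_ext P.isLimit _ _ fun k => ?_
  -- After composing with `p_k`, orthogonality leaves only the `k`-th summand.
  rw [sum_comp, Category.id_comp, Finset.sum_eq_single k]
  · have h : dag (P.fan.proj k) ≫ P.fan.proj k = 𝟙 _ := P.coisometric k
    rw [Category.assoc, h, Category.comp_id]
  · intro i _ hi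
    rw [Category.assoc, P.orthogonal k i hi.symm, comp_zero]
  · exact fun h => absurd (Finset.mem_univ k) h

/-- A Pythagorean identity, obtained by inserting the resolution of the identity between `g` and
`g^*`. -/
theorem comp_dag_eq_sum {ι : Type w} [Fintype ι] {X : ι → C} (P : OrthonormalProduct X) {Y : C}
    (g : Y ⟶ P.fan.pt) :
    g ≫ dag g = ∑ i, (g ≫ P.fan.proj i) ≫ dag (g ≫ P.fan.proj i) := by
  conv_lhs => rw [← Category.id_comp (dag g), ← sum_proj_dag_proj P, sum_comp, comp_sum]
  refine Finset.sum_congr rfl fun i _ => ?_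
  rw [dag_comp, Category.assoc, Category.assoc]

/-! ### The diagram of finite products consists of coisometric contractions. -/

section FiniteProductDiagram

variable {J : Type w} {X : J → C} (P : ∀ F : Finset J, OrthonormalProduct (fun j : F => X j))

theorem diagram_comp_dag (F : (Finset J)ᵒᵖ) {Y : C} (g : Y ⟶ (finiteProductDiagram P).obj F) :
    g ≫ dag g = ∑ j : F.unop, (g ≫ diagramProj P F j) ≫ dag (g ≫ diagramProj P F j) :=
  comp_dag_eq_sum (P F.unop) g

/-- By orthonormality both sides have components `1` at `k` and `0` elsewhere. -/
theorem dag_diagramProj_comp_map {G F : (Finset J)ᵒᵖ} (f : G ⟶ F) (k : F.unop) :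
    dag (diagramProj P G ⟨k.1, leOfHom f.unop k.2⟩) ≫ (finiteProductDiagram P).map f =
      dag (diagramProj P F k) := by
  refine diagram_hom_ext P fun j => ?_
  rw [Category.assoc, diagramMap_proj]
  obtain rfl | h := eq_or_ne j k
  · exact ((P G.unop).coisometric _).trans ((P F.unop).coisometric j).symm
  · exact ((P G.unop).orthogonal _ _ fun e => h (Subtype.ext (Subtype.mk.inj e))).trans
      ((P F.unop).orthogonal j k h).symm

/-- Taking adjoints in the previous lemma gives `p_k p_F^* = p_k`, with the left `p_k` projecting
from the product over `G` and the right one from that over `F`. As `p_k p_F` is the former, `p_F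
p_F^*` has the same components as `1`. -/
theorem isCoisometric_diagramMap {G F : (Finset J)ᵒᵖ} (f : G ⟶ F) :
    IsCoisometric ((finiteProductDiagram P).map f) := by
  refine diagram_hom_ext P fun k => ?_
  have h := congrArg dag (dag_diagramProj_comp_map P f k)
  rw [dag_comp, dag_dag, dag_dag] at h
  rw [Category.assoc, diagramMap_proj, h, Category.id_comp]

theorem isContraction_diagramMap {G F : (Finset J)ᵒᵖ} (f : G ⟶ F) :
    IsContraction ((finiteProductDiagram P).map f) := by
  classical
  have hFG : F.unop ⊆ G.unop := leOfHom f.unop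
  have hsub : G.unop \ F.unop ⊆ G.unop := Finset.sdiff_subset
  -- Extending `p_j^* p_j` by zero outside `G` turns sums over the subtypes of `F`, `G` and `G \ F`
  -- into sums of one function on `J`.
  let T : J → ((finiteProductDiagram P).obj G ⟶ (finiteProductDiagram P).obj G) := fun j =>
    if h : j ∈ G.unop then diagramProj P G ⟨j, h⟩ ≫ dag (diagramProj P G ⟨j, h⟩) else 0
  have hT : ∀ (j : J) (h : j ∈ G.unop),
      diagramProj P G ⟨j, h⟩ ≫ dag (diagramProj P G ⟨j, h⟩) = T j :=
    fun j h => by simp only [T, dif_pos h]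
  -- The witness of `p_F^* p_F ≤ 1` is the complementary projection `h` onto the product over `G \
  -- F`: `p_F^* p_F + h^* h` is the resolution of the identity over `G`.
  refine ⟨_, diagramLift P (Opposite.op (G.unop \ F.unop))
    fun j => diagramProj P G ⟨j.1, hsub j.2⟩, ?_⟩
  have h₁ : 𝟙 ((finiteProductDiagram P).obj G) = ∑ j ∈ G.unop, T j := by
    rw [← Finset.sum_coe_sort]
    exact (sum_proj_dag_proj (P G.unop)).symm.trans (Finset.sum_congr rfl fun j _ => hT j.1 j.2)
  rw [h₁, ← Finset.sum_sdiff hFG, add_comm, diagram_comp_dag, diagram_comp_dag,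
    ← Finset.sum_coe_sort (G.unop \ F.unop), ← Finset.sum_coe_sort F.unop]
  refine congrArg₂ (· + ·) (Finset.sum_congr rfl fun j _ => ?_)
    (Finset.sum_congr rfl fun j _ => ?_)
  · rw [diagramLift_proj]
    exact hT j.1 (hsub j.2)
  · rw [diagramMap_proj]
    exact hT j.1 (hFG j.2)

/-! ### Spans compared with cones. -/

theorem spanToCone_comp_dag (s : Fan X) (F : Finset J) :
    ((spanToCone P).obj s).π.app (Opposite.op F) ≫
      dag (((spanToCone P).obj s).π.app (Opposite.op F)) =
    ∑ j ∈ F, s.proj j ≫ dag (s.proj j) := by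
  have h : ∀ j : F, ((spanToCone P).obj s).π.app (Opposite.op F) ≫
      diagramProj P (Opposite.op F) j = s.proj j.1 := diagramLift_proj P _ _
  have hsum := diagram_comp_dag P (Opposite.op F) (((spanToCone P).obj s).π.app (Opposite.op F))
  have h' : ∑ j : F, s.proj j.1 ≫ dag (s.proj j.1) = ∑ j ∈ F, s.proj j ≫ dag (s.proj j) :=
    Finset.sum_coe_sort F fun j => s.proj j ≫ dag (s.proj j)
  rw [← h']
  exact hsum.trans (congrArg (fun f : ∀ j : F, s.pt ⟶ X j.1 => ∑ j, f j ≫ dag (f j)) (funext h))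

theorem isL2Span_iff (s : Fan X) : IsL2Span s ↔ IsL2Cone ((spanToCone P).obj s) := by
  have e := funext (spanToCone_comp_dag P s)
  exact exists_congr fun b => iff_of_eq (congrArg (IsUpperBound · b) e.symm)

theorem coneToSpan_obj_spanToCone_obj (s : Fan X) :
    (coneToSpan P).obj ((spanToCone P).obj s) = s :=
  cone_mk_ext fun ⟨j⟩ => diagramLift_proj P (Opposite.op {j}) (fun i => s.proj i.1)
    ⟨j, Finset.mem_singleton_self j⟩

/-- A cone is determined by its legs at singletons: compatibility along `{j} ⊆ F` makes the `j`-th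
component of the leg at `F` equal to that of the leg at `{j}`. -/
theorem spanToCone_obj_coneToSpan_obj (c : Cone (finiteProductDiagram P)) :
    (spanToCone P).obj ((coneToSpan P).obj c) = c := by
  refine cone_mk_ext (c := c) fun F => diagram_hom_ext P fun j => ?_
  have hj : ({j.1} : Finset J) ⊆ F.unop := Finset.singleton_subset_iff.2 j.2
  refine (diagramLift_proj P F _ j).trans ?_
  have h := c.w (homOfLE hj).op
  change c.π.app (Opposite.op {j.1}) ≫ _ = _
  rw [← h, Category.assoc]
  exact congrArg (c.π.app F ≫ ·) (diagramMap_proj P _ _)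

/-- Both functors keep the underlying morphisms, so only the equality of objects needs an argument.
-/
theorem spanToCone_comp_coneToSpan : spanToCone P ⋙ coneToSpan P = 𝟭 (Fan X) :=
  endofunctor_cone_eq_id _ (coneToSpan_obj_spanToCone_obj P) fun _ => HEq.rfl

theorem coneToSpan_comp_spanToCone :
    coneToSpan P ⋙ spanToCone P = 𝟭 (Cone (finiteProductDiagram P)) :=
  endofunctor_cone_eq_id _ (spanToCone_obj_coneToSpan_obj P) fun _ => HEq.rfl

/-- A morphism is compatible with two spans iff it is compatible with the corresponding cones. -/
theorem comp_proj_iff (s t : Fan X) (g : t.pt ⟶ s.pt) :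
    (∀ F, g ≫ ((spanToCone P).obj s).π.app F = ((spanToCone P).obj t).π.app F) ↔
      ∀ j, g ≫ s.proj j = t.proj j := by
  have hs : ∀ (s : Fan X) (F : (Finset J)ᵒᵖ) (j : F.unop),
      ((spanToCone P).obj s).π.app F ≫ diagramProj P F j = s.proj j.1 :=
    fun s F j => diagramLift_proj P F _ j
  constructor
  · intro h j
    have h' := congrArg (· ≫ diagramProj P (Opposite.op {j}) ⟨j, Finset.mem_singleton_self j⟩)
      (h (Opposite.op {j}))
    have h'' := (Category.assoc _ _ _).symm.trans (h'.trans (hs t _ _))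
    exact (congrArg (g ≫ ·) (hs s (Opposite.op {j}) ⟨j, Finset.mem_singleton_self j⟩)).symm.trans
      h''
  · intro h F
    refine diagram_hom_ext P fun j => ?_
    refine (Category.assoc _ _ _).trans ?_
    exact (congrArg (g ≫ ·) (hs s F j)).trans ((h j.1).trans (hs t F j).symm)

theorem isL2Product_iff (s : Fan X) : IsL2Product s ↔ IsL2Limit ((spanToCone P).obj s) := by
  -- For a single test span, the two universal properties agree clause by clause.
  have key : ∀ t : Fan X,
      ((IsL2Span t → (∃! g : t.pt ⟶ s.pt, ∀ j, g ≫ s.proj j = t.proj j) ∧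
        ∀ g : t.pt ⟶ s.pt, (∀ j, g ≫ s.proj j = t.proj j) →
          IsSupremum (fun F : Finset J => ∑ j ∈ F, t.proj j ≫ dag (t.proj j)) (g ≫ dag g)) ↔
      (IsL2Cone ((spanToCone P).obj t) →
        (∃! g : t.pt ⟶ s.pt,
          ∀ F, g ≫ ((spanToCone P).obj s).π.app F = ((spanToCone P).obj t).π.app F) ∧
        ∀ g : t.pt ⟶ s.pt,
          (∀ F, g ≫ ((spanToCone P).obj s).π.app F = ((spanToCone P).obj t).π.app F) →
          IsSupremum (fun F : Finset J => ((spanToCone P).obj t).π.app (Opposite.op F) ≫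
            dag (((spanToCone P).obj t).π.app (Opposite.op F))) (g ≫ dag g))) := by
    intro t
    have e := funext (spanToCone_comp_dag P t)
    simp only [comp_proj_iff, isL2Span_iff P t]
    exact imp_congr_right fun _ => and_congr_right fun _ => forall_congr' fun g =>
      imp_congr_right fun _ => iff_of_eq (congrArg (IsSupremum · (g ≫ dag g)) e.symm)
  refine and_congr (isL2Span_iff P s) ⟨fun h t => ?_, fun h t => (key t).2 (h _)⟩
  -- Every test cone comes from a span, so testing against spans is enough.
  rw [← spanToCone_obj_coneToSpan_obj P t]
  exact (key _).1 (h _)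

end FiniteProductDiagram

end PreHilbertStarCategory

/-! ### Existence of `ℓ²`-products and the main theorem. -/

theorem HilbertStarCategory.exists_isL2Product {C : Type u} [Category.{v} C] [StarCategory C]
    [HilbertStarCategory.{w} C] {J : Type w} (X : J → C) : ∃ s : Fan X, IsL2Product s := by
  have P : ∀ F : Finset J, OrthonormalProduct (fun j : F => X j) :=
    fun F => (nonempty_orthonormalProduct fun j : F => X j).some
  obtain ⟨c, hc⟩ := HilbertStarCategory.exists_l2Limit (Finset J) (finiteProductDiagram P)
    (isContraction_diagramMap P)
  refine ⟨(coneToSpan P).obj c, (isL2Product_iff P _).2 ?_⟩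
  rwa [spanToCone_obj_coneToSpan_obj]

theorem mainTheorem9 {C : Type u} [Category.{v} C] [StarCategory C] [PreHilbertStarCategory C] :
    (∀ {J : Type w} (X : J → C),
      (∀ F : Finset J, Nonempty (OrthonormalProduct (fun j : F => X j))) ∧
      ∀ P : (∀ F : Finset J, OrthonormalProduct (fun j : F => X j)),
        (∀ {G F : (Finset J)ᵒᵖ} (f : G ⟶ F),
          IsCoisometric ((finiteProductDiagram P).map f) ∧
          IsContraction ((finiteProductDiagram P).map f)) ∧
        (spanToCone P ⋙ coneToSpan P = 𝟭 (Fan X) ∧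
          coneToSpan P ⋙ spanToCone P = 𝟭 (Cone (finiteProductDiagram P))) ∧
        (∀ s : Fan X, IsL2Span s ↔ IsL2Cone ((spanToCone P).obj s)) ∧
        (∀ s : Fan X, IsL2Product s ↔ IsL2Limit ((spanToCone P).obj s))) ∧
    (HilbertStarCategory.{w} C →
      ∀ {J : Type w} (X : J → C), ∃ s : Fan X, IsL2Product s) :=
  ⟨fun X => ⟨fun F => nonempty_orthonormalProduct fun j : F => X j, fun P =>
    ⟨fun f => ⟨isCoisometric_diagramMap P f, isContraction_diagramMap P f⟩,
      ⟨spanToCone_comp_coneToSpan P, coneToSpan_comp_spanToCone P⟩,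
      isL2Span_iff P, isL2Product_iff P⟩⟩,
    fun _ _ X => HilbertStarCategory.exists_isL2Product X⟩
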